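/- Let $K$ be a field, let $S=K[x_1,\dots,x_n]$ with $n\ge 1$, let $\mathfrak m=(x_1,\dots,x_n)$, and let $I\subseteq S$ be a monomial ideal. For a monomial ideal $J\subseteq S$ let $\mathcal G(J)$ be its minimal set of monomial generators, let $\partial(J)$ (the gradient ideal of $J$) be the ideal generated by all partial derivatives $\partial u/\partial x_i$ with $u\in\mathcal G(J)$ and $1\le i\le n$, and let $\partial^*(J)=(u/x_i : u\in\mathcal G(J),\ x_i \text{ divides } u)$. The ideal $J$ has linear quotients if the elements of $\mathcal G(J)$ can be ordered as $u_1,\dots,u_m$ so that $(u_1,\dots,u_{i-1}):(u_i)$ is generated by a set of variables for every $i=2,\dots,m$. Put $\operatorname{reg}J=\max\{j-i:\dim_K\operatorname{Tor}^S_i(K,J)_j\ne0\}$, with $\operatorname{reg}(0)=-\infty$. Then there is an integer $k_0$ such that the following holds for every $k\ge k_0$ for which $\operatorname{char}K=0$ or, more generally, $\partial(I)=\partial^*(I)$ and $\partial(\mathfrak m^kI)=\partial^*(\mathfrak m^kI)$: 1. if $I\ne S$, then $\partial(\mathfrak m^kI)=\mathfrak m^k\,\partial(I)$; 2. $\partial(\mathfrak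 m^kI)$ has linear quotients; 3. if $I\ne 0$, then $\operatorname{reg}\partial(\mathfrak m^kI)<\operatorname{reg}(\mathfrak m^kI)$. -/

import Mathlib

open MvPolynomial

noncomputable section

namespace MonomialGradient

variable {K : Type*} [Field K] {n : ℕ}

/-- `I` is a monomial ideal: it is generated by a set of monomials. -/
def IsMonomialIdeal (I : Ideal (MvPolynomial (Fin n) K)) : Prop :=
  ∃ A : Set (Fin n →₀ ℕ), I = Ideal.span ((fun a => monomial a (1 : K)) '' A)

/-- The exponent vectors of the minimal monomial generators `𝒢(I)` of a monomial ideal `I`: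
the monomials of `I` that are minimal with respect to divisibility. -/
def minGens (I : Ideal (MvPolynomial (Fin n) K)) : Set (Fin n →₀ ℕ) :=
  {a | Minimal (fun b => monomial b (1 : K) ∈ I) a}

/-- The gradient ideal `∂(I)` of a monomial ideal `I`: the ideal generated by all partial
derivatives of the minimal monomial generators of `I`. -/
def gradient (I : Ideal (MvPolynomial (Fin n) K)) : Ideal (MvPolynomial (Fin n) K) :=
  Ideal.span {f | ∃ a ∈ minGens I, ∃ i : Fin n, f = pderiv i (monomial a (1 : K))}

/-- The ideal `∂*(I) = (u / x_i : u ∈ 𝒢(I), i ∈ supp u)`. -/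
def gradientStar (I : Ideal (MvPolynomial (Fin n) K)) : Ideal (MvPolynomial (Fin n) K) :=
  Ideal.span {f | ∃ a ∈ minGens I, ∃ i ∈ a.support,
    f = monomial (a - Finsupp.single i 1) (1 : K)}

/-- A monomial ideal has linear quotients if its minimal monomial generators can be listed as
`u_1, …, u_m`, without repetition, so that each colon ideal `(u_1, …, u_{i-1}) : (u_i)` with
`i ≥ 2` is generated by a set of variables (positions are counted from `0` below). -/
def HasLinearQuotients (I : Ideal (MvPolynomial (Fin n) K)) : Prop :=
  IsMonomialIdeal I ∧
  ∃ (m : ℕ) (u : Fin m → (Fin n →₀ ℕ)), Function.Injective u ∧ Set.range u = minGens I ∧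
    ∀ i : Fin m, 0 < (i : ℕ) → ∃ V : Set (Fin n),
      (Ideal.span {f | ∃ j < i, f = monomial (u j) (1 : K)}).colon
          (Ideal.span {monomial (u i) (1 : K)} : Ideal (MvPolynomial (Fin n) K))
        = Ideal.span ((fun v => (X v : MvPolynomial (Fin n) K)) '' V)

/-- The differential of the Koszul complex of `x_1, …, x_n` over `S = K[x_1, …, x_n]`.
An element of the exterior algebra `⋀ Sⁿ` is written as `∑_F c_F e_F` with `F` running over the
subsets of the index set, and `e_F ↦ ∑_{p ∈ F} (-1)^{#{q ∈ F, q < p}} x_p e_{F ∖ {p}}`;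
below is the coefficient of `e_G` in the image of `c`. -/
def koszulD (K : Type*) [Field K] (n : ℕ) :
    (Finset (Fin n) → MvPolynomial (Fin n) K) →ₗ[K] (Finset (Fin n) → MvPolynomial (Fin n) K) :=
  LinearMap.pi fun G =>
    ∑ p ∈ Gᶜ, (LinearMap.mulLeft K
      ((-1) ^ (G.filter (· < p)).card * X p : MvPolynomial (Fin n) K)).comp
        (LinearMap.proj (insert p G))

theorem koszulD_apply (c : Finset (Fin n) → MvPolynomial (Fin n) K) (G : Finset (Fin n)) :
    koszulD K n c G = ∑ p ∈ Gᶜ, (-1) ^ (G.filter (· < p)).card * X p * c (insert p G) := by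
  simp [koszulD, mul_assoc]

/-- The Koszul differential squares to zero. -/
theorem koszulD_koszulD (c : Finset (Fin n) → MvPolynomial (Fin n) K) :
    koszulD K n (koszulD K n c) = 0 := by
  classical
  ext1 G
  simp only [koszulD_apply, Finset.mul_sum, Pi.zero_apply]
  rw [Finset.sum_sigma']
  refine Finset.sum_involution (fun x _ => ⟨x.2, x.1⟩) ?_ ?_ ?_ ?_
  · rintro ⟨p, q⟩ h
    simp only [Finset.mem_sigma, Finset.mem_compl, Finset.mem_insert, not_or] at h
    obtain ⟨hp, hqp, hq⟩ := h
    have key : ∀ p q : Fin n, p ∉ G → (((insert p G).filter (· < q)).card) =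
        (G.filter (· < q)).card + if p < q then 1 else 0 := by
      intro p q hp
      rw [Finset.filter_insert]; split_ifs <;> simp [hp]
    simp only [key p q hp, key q p hq, Finset.insert_comm q p G]
    rcases lt_or_gt_of_ne hqp with h | h
    · simp [h, not_lt.2 h.le, pow_succ]; ring
    · simp [h, not_lt.2 h.le, pow_succ]; ring
  · rintro ⟨p, q⟩ h _ h'
    simp at h h'
    exact h.2.1 h'.1
  · rintro ⟨p, q⟩ h
    simp at h ⊢
    exact ⟨h.2.2, fun h' => h.2.1 h'.symm, h.1⟩
  · rintro ⟨p, q⟩ h; rfl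

/-- The component of homological degree `i` and internal degree `j` of the complex
`𝒦 ⊗_S I`, where `𝒦` is the Koszul complex of `x_1, …, x_n` (the minimal graded free resolution
of `K` over `S`): the sums `∑_{#F = i} c_F e_F` with `c_F ∈ I` homogeneous of degree `j - i`
(the basis element `e_F` has internal degree `#F`). -/
def koszulChains (I : Ideal (MvPolynomial (Fin n) K)) (i j : ℕ) :
    Submodule K (Finset (Fin n) → MvPolynomial (Fin n) K) where
  carrier := {c | ∀ F, c F ∈ I ∧ (F.card ≠ i → c F = 0) ∧
    ∀ a ∈ (c F).support, a.degree + i = j}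
  zero_mem' := by simp
  add_mem' := by
    intro c d hc hd F
    refine ⟨I.add_mem (hc F).1 (hd F).1, fun h => ?_, fun a ha => ?_⟩
    · simp [(hc F).2.1 h, (hd F).2.1 h]
    · classical
      rcases Finset.mem_union.1 (support_add ha) with h | h
      · exact (hc F).2.2 a h
      · exact (hd F).2.2 a h
  smul_mem' := by
    intro r c hc F
    refine ⟨Submodule.smul_of_tower_mem I r (hc F).1, fun h => ?_, fun a ha => ?_⟩
    · simp [(hc F).2.1 h]
    · exact (hc F).2.2 a (support_smul ha)

/-- Cycles of bidegree `(i, j)` in `𝒦 ⊗_S I`. -/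
def koszulCycles (I : Ideal (MvPolynomial (Fin n) K)) (i j : ℕ) :
    Submodule K (Finset (Fin n) → MvPolynomial (Fin n) K) :=
  koszulChains I i j ⊓ LinearMap.ker (koszulD K n)

/-- Boundaries of bidegree `(i, j)` in `𝒦 ⊗_S I`. -/
def koszulBoundaries (I : Ideal (MvPolynomial (Fin n) K)) (i j : ℕ) :
    Submodule K (Finset (Fin n) → MvPolynomial (Fin n) K) :=
  (koszulChains I (i + 1) j).map (koszulD K n)

/-- `Tor_i^S(K, I)_j`, computed as the homology in bidegree `(i, j)` of `𝒦 ⊗_S I`, where `𝒦` is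
the graded free resolution of `K` given by the Koszul complex. -/
abbrev gradedTor (I : Ideal (MvPolynomial (Fin n) K)) (i j : ℕ) : Type _ :=
  koszulCycles I i j ⧸ (koszulBoundaries I i j).submoduleOf (koszulCycles I i j)

/-- The graded Betti number `β_{i,j}(I) = dim_K Tor_i^S(K, I)_j`. -/
def gradedBetti (I : Ideal (MvPolynomial (Fin n) K)) (i j : ℕ) : Cardinal :=
  Module.rank K (gradedTor I i j)

/-- The Castelnuovo-Mumford regularity `reg I = sup {j - i : β_{i,j}(I) ≠ 0}`, as an extended
real number; the zero ideal has regularity `-∞`. -/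
def reg (I : Ideal (MvPolynomial (Fin n) K)) : EReal :=
  sSup {r | ∃ i j : ℕ, gradedBetti I i j ≠ 0 ∧ r = (((j : ℝ) - (i : ℝ) : ℝ) : EReal)}

end MonomialGradient

end

noncomputable section

namespace MonomialGradient

open scoped Pointwise

variable {K : Type*} [Field K] {n : ℕ}

/-! Since $\partial$ and $\partial^*$ agree on the ideals involved, everything is proved for
$\partial^*$. For $I\ne S$, a monomial $b$ lies in $\partial^*(I)$ iff some $x_ib$ lies in $I$,
whence $\partial^*(\mathfrak m^kI)=\mathfrak m^k\partial^*(I)$ for all $k$ (`gradientStar_pow_mul`).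
So for large $k$ the ideal $\partial^*(\mathfrak m^kI)$ is $\mathfrak m^l J$ with a fixed monomial
ideal $J$.

Let $c$ bound all exponents in $\mathcal G(J)$ and let $l>nc$. Each monomial of $\mathfrak m^lJ$ has
degree above $nc$, so by pigeonhole some exponent exceeds $c$; lowering that exponent keeps
divisibility by every generator of $J$ dividing the monomial. This freedom is used twice: to
exchange variables for linear quotients (`hasLinearQuotients_pow_mul`), and to contract Koszul
cycles, which bounds $\operatorname{reg}(\mathfrak m^lJ)$ by the largest degree of a generator
(`koszulCycles_le_koszulBoundaries`, `reg_pow_mul_le`).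

Generators of $\partial^*(\mathfrak m^kI)$ have degree one less than some generator of $\mathfrak
m^kI$, while $\operatorname{reg}(\mathfrak m^kI)$ is at least its largest generator degree by
$\operatorname{Tor}_0$ (`le_reg`). This gives the strict inequality. -/

/-! ### Monomial ideals, their minimal generators, and products with powers of $\mathfrak m$. -/

theorem monomial_mem_of_le {I : Ideal (MvPolynomial (Fin n) K)} {a b : Fin n →₀ ℕ} (h : a ≤ b)
    (ha : monomial a (1 : K) ∈ I) : monomial b (1 : K) ∈ I := by
  have : monomial b (1 : K) = monomial (b - a) 1 * monomial a 1 := by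
    rw [monomial_mul, tsub_add_cancel_of_le h, mul_one]
  rw [this]
  exact I.mul_mem_left _ ha

theorem exists_minGens_le {I : Ideal (MvPolynomial (Fin n) K)} {a : Fin n →₀ ℕ}
    (ha : monomial a (1 : K) ∈ I) : ∃ v ∈ minGens I, v ≤ a := by
  obtain ⟨v, hva, hv⟩ :=
    exists_minimal_le_of_wellFoundedLT (fun b => monomial b (1 : K) ∈ I) a ha
  exact ⟨v, hv, hva⟩

theorem monomial_mem_iff_minGens {I : Ideal (MvPolynomial (Fin n) K)} {a : Fin n →₀ ℕ} :
    monomial a (1 : K) ∈ I ↔ ∃ v ∈ minGens I, v ≤ a :=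
  ⟨exists_minGens_le, fun ⟨_, hv, hva⟩ => monomial_mem_of_le hva hv.1⟩

theorem minGens_finite (I : Ideal (MvPolynomial (Fin n) K)) : (minGens I).Finite :=
  WellQuasiOrderedLE.finite_of_isAntichain (setOfPred_minimal_antichain _)

theorem monomial_mem_span_iff {A : Set (Fin n →₀ ℕ)} {a : Fin n →₀ ℕ} :
    monomial a (1 : K) ∈ Ideal.span ((fun a => monomial a (1 : K)) '' A) ↔ ∃ v ∈ A, v ≤ a := by
  classical
  rw [mem_ideal_span_monomial_image]
  simp [support_monomial]

theorem IsMonomialIdeal.mem_iff {I : Ideal (MvPolynomial (Fin n) K)} (hI : IsMonomialIdeal I)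
    {f : MvPolynomial (Fin n) K} : f ∈ I ↔ ∀ a ∈ f.support, monomial a (1 : K) ∈ I := by
  obtain ⟨A, rfl⟩ := hI
  simp only [monomial_mem_span_iff]
  exact mem_ideal_span_monomial_image

theorem IsMonomialIdeal.le_of_monomial {I J : Ideal (MvPolynomial (Fin n) K)}
    (hI : IsMonomialIdeal I)
    (h : ∀ a, monomial a (1 : K) ∈ I → monomial a (1 : K) ∈ J) : I ≤ J := by
  obtain ⟨A, rfl⟩ := hI
  rw [Ideal.span_le]
  rintro _ ⟨a, ha, rfl⟩
  exact h a (Ideal.subset_span ⟨a, ha, rfl⟩)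

theorem IsMonomialIdeal.ext {I J : Ideal (MvPolynomial (Fin n) K)} (hI : IsMonomialIdeal I)
    (hJ : IsMonomialIdeal J)
    (h : ∀ a, monomial a (1 : K) ∈ I ↔ monomial a (1 : K) ∈ J) : I = J :=
  le_antisymm (hI.le_of_monomial fun a => (h a).1) (hJ.le_of_monomial fun a => (h a).2)

theorem IsMonomialIdeal.span_minGens {I : Ideal (MvPolynomial (Fin n) K)}
    (hI : IsMonomialIdeal I) :
    I = Ideal.span ((fun a => monomial a (1 : K)) '' minGens I) :=
  hI.ext ⟨_, rfl⟩ fun _ => monomial_mem_iff_minGens.trans monomial_mem_span_iff.symm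

theorem monomial_image_mul (A B : Set (Fin n →₀ ℕ)) :
    (fun a => monomial a (1 : K)) '' A * (fun a => monomial a (1 : K)) '' B =
      (fun a => monomial a (1 : K)) '' Set.image2 (· + ·) A B := by
  ext f
  constructor
  · rintro ⟨_, ⟨a, ha, rfl⟩, _, ⟨b, hb, rfl⟩, rfl⟩
    exact ⟨a + b, ⟨a, ha, b, hb, rfl⟩, by simp⟩
  · rintro ⟨_, ⟨a, ha, b, hb, rfl⟩, rfl⟩
    exact ⟨_, ⟨a, ha, rfl⟩, _, ⟨b, hb, rfl⟩, by simp⟩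

theorem IsMonomialIdeal.mul {I J : Ideal (MvPolynomial (Fin n) K)} (hI : IsMonomialIdeal I)
    (hJ : IsMonomialIdeal J) : IsMonomialIdeal (I * J) := by
  obtain ⟨A, rfl⟩ := hI
  obtain ⟨B, rfl⟩ := hJ
  refine ⟨Set.image2 (· + ·) A B, ?_⟩
  rw [Ideal.span_mul_span', monomial_image_mul]

theorem isMonomialIdeal_pow_idealOfVars (k : ℕ) :
    IsMonomialIdeal (idealOfVars (Fin n) K ^ k) :=
  ⟨_, pow_idealOfVars_eq_span k⟩

theorem IsMonomialIdeal.pow_mul {J : Ideal (MvPolynomial (Fin n) K)} (hJ : IsMonomialIdeal J)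
    (k : ℕ) : IsMonomialIdeal (idealOfVars (Fin n) K ^ k * J) :=
  (isMonomialIdeal_pow_idealOfVars k).mul hJ

/-- Every monomial of degree at least $k$ lies in $\mathfrak m^k$, so only the degree of the
cofactor $a-v$ matters. This turns all later membership questions into arithmetic. -/
theorem monomial_mem_pow_mul_iff {J : Ideal (MvPolynomial (Fin n) K)} (hJ : IsMonomialIdeal J)
    {k : ℕ} {a : Fin n →₀ ℕ} :
    monomial a (1 : K) ∈ idealOfVars (Fin n) K ^ k * J ↔
      ∃ v, monomial v (1 : K) ∈ J ∧ v ≤ a ∧ v.degree + k ≤ a.degree := by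
  constructor
  · intro h
    rw [hJ.span_minGens, pow_idealOfVars_eq_span, Ideal.span_mul_span', monomial_image_mul,
      monomial_mem_span_iff] at h
    obtain ⟨_, ⟨w, hw, v, hv, rfl⟩, hle⟩ := h
    refine ⟨v, hv.1, le_trans le_add_self hle, ?_⟩
    have := Finsupp.degree_mono hle
    simp only [map_add] at this
    have hw' : w.degree = k := hw
    omega
  · rintro ⟨v, hv, hva, hd⟩
    obtain ⟨w, rfl⟩ := le_iff_exists_add.mp hva
    have : monomial (v + w) (1 : K) = monomial w 1 * monomial v 1 := by
      rw [monomial_mul, add_comm, mul_one]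
    rw [this]
    refine Ideal.mul_mem_mul ?_ hv
    rw [monomial_mem_pow_idealOfVars_iff _ _ one_ne_zero]
    simp only [map_add] at hd
    omega

theorem ne_top_iff_zero_notMem {I : Ideal (MvPolynomial (Fin n) K)} :
    I ≠ ⊤ ↔ monomial (0 : Fin n →₀ ℕ) (1 : K) ∉ I := by
  rw [Ne, Ideal.eq_top_iff_one]; rfl

theorem degree_sub_single {a : Fin n →₀ ℕ} {i : Fin n} (h : a i ≠ 0) :
    (a - Finsupp.single i 1).degree + 1 = a.degree := by
  have : Finsupp.single i 1 ≤ a := by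
    rw [Finsupp.single_le_iff]; omega
  conv_rhs => rw [← tsub_add_cancel_of_le this]
  simp

/-! ### The ideal $\partial^*$ and its behaviour under multiplication by $\mathfrak m^k$. -/

theorem isMonomialIdeal_gradientStar (I : Ideal (MvPolynomial (Fin n) K)) :
    IsMonomialIdeal (gradientStar I) := by
  refine ⟨{b | ∃ a ∈ minGens I, ∃ i ∈ a.support, b = a - Finsupp.single i 1}, ?_⟩
  rw [gradientStar]
  congr 1
  ext f
  constructor
  · rintro ⟨a, ha, i, hi, rfl⟩
    exact ⟨_, ⟨a, ha, i, hi, rfl⟩, rfl⟩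
  · rintro ⟨_, ⟨a, ha, i, hi, rfl⟩, rfl⟩
    exact ⟨a, ha, i, hi, rfl⟩

theorem monomial_mem_gradientStar_iff_exists_le {I : Ideal (MvPolynomial (Fin n) K)}
    {b : Fin n →₀ ℕ} : monomial b (1 : K) ∈ gradientStar I ↔
      ∃ a ∈ minGens I, ∃ i ∈ a.support, a - Finsupp.single i 1 ≤ b := by
  have : {f | ∃ a ∈ minGens I, ∃ i ∈ a.support,
      f = monomial (a - Finsupp.single i 1) (1 : K)} = (fun a => monomial a (1 : K)) ''
        {b | ∃ a ∈ minGens I, ∃ i ∈ a.support, b = a - Finsupp.single i 1} := by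
    ext f
    constructor
    · rintro ⟨a, ha, i, hi, rfl⟩
      exact ⟨_, ⟨a, ha, i, hi, rfl⟩, rfl⟩
    · rintro ⟨_, ⟨a, ha, i, hi, rfl⟩, rfl⟩
      exact ⟨a, ha, i, hi, rfl⟩
  rw [gradientStar, this, monomial_mem_span_iff]
  constructor
  · rintro ⟨_, ⟨a, ha, i, hi, rfl⟩, h⟩
    exact ⟨a, ha, i, hi, h⟩
  · rintro ⟨a, ha, i, hi, h⟩
    exact ⟨_, ⟨a, ha, i, hi, rfl⟩, h⟩

/-- This description avoids minimal generators. Properness is essential: $\partial^*(S)=0$, because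
the generator $1$ has no variable to remove. -/
theorem monomial_mem_gradientStar_iff {I : Ideal (MvPolynomial (Fin n) K)} (hI : I ≠ ⊤)
    {b : Fin n →₀ ℕ} : monomial b (1 : K) ∈ gradientStar I ↔
      ∃ i, monomial (b + Finsupp.single i 1) (1 : K) ∈ I := by
  rw [monomial_mem_gradientStar_iff_exists_le]
  constructor
  · rintro ⟨a, ha, i, -, h⟩
    exact ⟨i, monomial_mem_of_le (tsub_le_iff_right.1 h) ha.1⟩
  · rintro ⟨i, hi⟩
    obtain ⟨a, ha, hab⟩ := exists_minGens_le hi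
    -- If $x_i$ does not divide the generator, the generator already divides $b$, and any of its
    -- variables may be removed.
    by_cases hia : a i = 0
    · have h0 : a ≠ 0 := by
        rintro rfl
        exact ne_top_iff_zero_notMem.1 hI ha.1
      obtain ⟨j, hj⟩ := Finsupp.support_nonempty_iff.2 h0
      refine ⟨a, ha, j, hj, tsub_le_self.trans fun l => ?_⟩
      rcases eq_or_ne l i with rfl | hl
      · simp [hia]
      · simpa [Finsupp.single_apply, hl.symm] using hab l
    · exact ⟨a, ha, i, Finsupp.mem_support_iff.2 hia, tsub_le_iff_right.2 hab⟩

theorem gradient_eq_gradientStar [CharZero K] (I : Ideal (MvPolynomial (Fin n) K)) :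
    gradient I = gradientStar I := by
  apply le_antisymm
  · rw [gradient, Ideal.span_le]
    rintro _ ⟨a, ha, i, rfl⟩
    rw [pderiv_monomial]
    by_cases h : a i = 0
    · simp [h]
    · have : monomial (a - Finsupp.single i 1) (1 * (a i : K)) =
          C (a i : K) * monomial (a - Finsupp.single i 1) 1 := by
        rw [C_mul_monomial, one_mul, mul_one]
      rw [this]
      exact Ideal.mul_mem_left _ _
        (Ideal.subset_span ⟨a, ha, i, Finsupp.mem_support_iff.2 h, rfl⟩)
  · rw [gradientStar, Ideal.span_le]
    rintro _ ⟨a, ha, i, hi, rfl⟩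
    have h : (a i : K) ≠ 0 := Nat.cast_ne_zero.2 (Finsupp.mem_support_iff.1 hi)
    have : monomial (a - Finsupp.single i 1) (1 : K) =
        C (a i : K)⁻¹ * pderiv i (monomial a (1 : K)) := by
      rw [pderiv_monomial, C_mul_monomial, one_mul, inv_mul_cancel₀ h]
    rw [SetLike.mem_coe, this]
    exact Ideal.mul_mem_left _ _ (Ideal.subset_span ⟨a, ha, i, rfl⟩)

theorem pow_mul_ne_top {I : Ideal (MvPolynomial (Fin n) K)} (hI : I ≠ ⊤) (k : ℕ) :
    idealOfVars (Fin n) K ^ k * I ≠ ⊤ :=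
  fun h => hI (top_le_iff.1 (h ▸ Ideal.mul_le_right))

/-- Over a proper monomial ideal, `∂*` commutes with multiplication by powers of the maximal
ideal. -/
theorem gradientStar_pow_mul {I : Ideal (MvPolynomial (Fin n) K)} (hI : IsMonomialIdeal I)
    (hI' : I ≠ ⊤) (k : ℕ) :
    gradientStar (idealOfVars (Fin n) K ^ k * I) =
      idealOfVars (Fin n) K ^ k * gradientStar I := by
  refine (isMonomialIdeal_gradientStar _).ext ((isMonomialIdeal_gradientStar I).pow_mul k)
    fun b => ?_
  rw [monomial_mem_gradientStar_iff (pow_mul_ne_top hI' k),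
    monomial_mem_pow_mul_iff (isMonomialIdeal_gradientStar I)]
  simp only [monomial_mem_pow_mul_iff hI, monomial_mem_gradientStar_iff hI']
  constructor
  · rintro ⟨i, v, hv, hvb, hd⟩
    -- Some variable can be removed from $v$ so that the quotient divides $b$; the degrees of $v$
    -- and of $b+e_i$ then both drop by one, so the gap $k$ survives.
    have key : ∃ j, v j ≠ 0 ∧ v - Finsupp.single j 1 ≤ b := by
      by_cases hi : v i = 0
      · have h0 : v ≠ 0 := by
          rintro rfl
          exact ne_top_iff_zero_notMem.1 hI' hv
        obtain ⟨j, hj⟩ := Finsupp.support_nonempty_iff.2 h0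
        refine ⟨j, Finsupp.mem_support_iff.1 hj, tsub_le_self.trans fun l => ?_⟩
        rcases eq_or_ne l i with rfl | hl
        · simp [hi]
        · simpa [Finsupp.single_apply, hl.symm] using hvb l
      · exact ⟨i, hi, tsub_le_iff_right.2 hvb⟩
    obtain ⟨j, hj, hle⟩ := key
    have hs : Finsupp.single j 1 ≤ v := by rw [Finsupp.single_le_iff]; omega
    refine ⟨v - Finsupp.single j 1, ⟨j, by rwa [tsub_add_cancel_of_le hs]⟩, hle, ?_⟩
    have := degree_sub_single hj
    simp only [map_add, Finsupp.degree_single] at hd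
    omega
  · rintro ⟨v, ⟨i, hi⟩, hvb, hd⟩
    refine ⟨i, _, hi, add_le_add_left hvb _, ?_⟩
    simp only [map_add, Finsupp.degree_single]
    omega

theorem gradientStar_pow_idealOfVars (hn : 0 < n) (k : ℕ) :
    gradientStar (idealOfVars (Fin n) K ^ (k + 1)) = idealOfVars (Fin n) K ^ k := by
  have h0 : idealOfVars (Fin n) K ^ (k + 1) ≠ ⊤ := by
    rw [ne_top_iff_zero_notMem, monomial_mem_pow_idealOfVars_iff _ _ one_ne_zero]
    simp
  refine (isMonomialIdeal_gradientStar _).ext (isMonomialIdeal_pow_idealOfVars k) fun b => ?_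
  rw [monomial_mem_gradientStar_iff h0]
  simp only [monomial_mem_pow_idealOfVars_iff _ _ (one_ne_zero (α := K)), map_add,
    Finsupp.degree_single, add_le_add_iff_right]
  exact ⟨fun ⟨_, h⟩ => h, fun h => ⟨⟨0, hn⟩, h⟩⟩

/-- Every minimal generator of `∂*(I)` is of the form `u / x_i` with `u` a minimal generator
of `I`. -/
theorem exists_of_mem_minGens_gradientStar {I : Ideal (MvPolynomial (Fin n) K)}
    {b : Fin n →₀ ℕ} (hb : b ∈ minGens (gradientStar I)) :
    ∃ a ∈ minGens I, b.degree + 1 = a.degree := by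
  obtain ⟨a, ha, i, hi, hle⟩ := monomial_mem_gradientStar_iff_exists_le.1 hb.1
  have hmem : monomial (a - Finsupp.single i 1) (1 : K) ∈ gradientStar I :=
    monomial_mem_gradientStar_iff_exists_le.2 ⟨a, ha, i, hi, le_rfl⟩
  refine ⟨a, ha, ?_⟩
  rw [le_antisymm (hb.2 hmem hle) hle]
  exact degree_sub_single (Finsupp.mem_support_iff.1 hi)

/-! ### Linear quotients of $\mathfrak m^kJ$ for large $k$. -/

/-- A monomial ideal has linear quotients if its generators, listed in increasing order of an
injective key, satisfy the exchange property below. -/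
theorem IsMonomialIdeal.hasLinearQuotients_of_key {α : Type*} [LinearOrder α]
    {I : Ideal (MvPolynomial (Fin n) K)} (hI : IsMonomialIdeal I) (key : (Fin n →₀ ℕ) → α)
    (hkey : Function.Injective key)
    (h : ∀ u ∈ minGens I, ∀ w ∈ minGens I, key w < key u →
      ∃ i, u i < w i ∧ ∃ u' ∈ minGens I, key u' < key u ∧ u' ≤ u + Finsupp.single i 1) :
    HasLinearQuotients I := by
  classical
  refine ⟨hI, ?_⟩
  set s : Finset α := (minGens_finite I).toFinset.image key with hs
  set e := s.orderEmbOfFin rfl with he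
  have hex : ∀ i, ∃ a ∈ minGens I, key a = e i := by
    intro i
    have : e i ∈ s := Finset.orderEmbOfFin_mem s rfl i
    simpa only [hs, Finset.mem_image, Set.Finite.mem_toFinset] using this
  choose u hu hue using hex
  have hrange : ∀ a ∈ minGens I, ∃ i, u i = a := by
    intro a ha
    have : key a ∈ Set.range e := by
      rw [he, Finset.range_orderEmbOfFin]
      simpa [hs] using ⟨a, ha, rfl⟩
    obtain ⟨i, hi⟩ := this
    exact ⟨i, hkey ((hue i).trans hi)⟩
  have hlt : ∀ i j, key (u i) < key (u j) ↔ i < j := by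
    intro i j
    rw [hue, hue, e.lt_iff_lt]
  refine ⟨s.card, u, fun i j hij => ?_, ?_, fun i _ => ?_⟩
  · exact e.injective (by rw [← hue, ← hue, hij])
  · ext a
    exact ⟨by rintro ⟨i, rfl⟩; exact hu i, hrange a⟩
  · have himage : {f | ∃ j < i, f = monomial (u j) (1 : K)} =
        (fun a => monomial a (1 : K)) '' (u '' Set.Iio i) := by
      ext f
      constructor
      · rintro ⟨j, hj, rfl⟩
        exact ⟨_, ⟨j, hj, rfl⟩, rfl⟩
      · rintro ⟨_, ⟨j, hj, rfl⟩, rfl⟩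
        exact ⟨j, hj, rfl⟩
    rw [himage]
    -- The variables that lie in the colon ideal.
    refine ⟨{v | ∃ j < i, u j ≤ u i + Finsupp.single v 1}, ?_⟩
    apply le_antisymm
    · intro f hf
      rw [Ideal.mem_colon_span_singleton, mem_ideal_span_monomial_image] at hf
      rw [mem_ideal_span_X_image]
      intro a ha
      have hmem : a + u i ∈ (f * monomial (u i) (1 : K)).support := by
        rw [mem_support_iff, coeff_mul_monomial, mul_one]
        exact mem_support_iff.1 ha
      obtain ⟨_, ⟨j, hj, rfl⟩, hle⟩ := hf _ hmem
      -- Here $u_j$ divides $x^a u_i$ and has a larger exponent at $v$ than $u_i$, so $x_v$ must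
      -- divide $x^a$.
      obtain ⟨v, hv, u', hu', hk, hle'⟩ := h _ (hu i) _ (hu j) ((hlt j i).2 hj)
      obtain ⟨l, rfl⟩ := hrange u' hu'
      refine ⟨v, ⟨l, (hlt l i).1 hk, hle'⟩, fun h0 => ?_⟩
      have := hle v
      simp only [Finsupp.add_apply, h0] at this
      omega
    · rw [Ideal.span_le]
      rintro _ ⟨v, ⟨j, hj, hle⟩, rfl⟩
      rw [SetLike.mem_coe, Ideal.mem_colon_span_singleton, mul_comm]
      have : monomial (u i) (1 : K) * X v = monomial (u i + Finsupp.single v 1) 1 := by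
        rw [X, monomial_mul, mul_one]
      rw [this, monomial_mem_span_iff]
      exact ⟨_, ⟨j, hj, rfl⟩, hle⟩

theorem exists_lt_apply_of_mul_lt_degree {c : ℕ} {a : Fin n →₀ ℕ} (h : n * c < a.degree) :
    ∃ j, c < a j := by
  by_contra! hc
  have : ∑ i, a i ≤ ∑ _i : Fin n, c := Finset.sum_le_sum fun i _ => hc i
  rw [Finsupp.degree_eq_sum] at h
  simp at this
  omega

/-- If `x^v` divides `x^a` and the exponent of `x_j` in `x^a` exceeds a bound on `v j`, then `x^v`
divides `x^a / x_j`. -/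
theorem le_sub_single {c : ℕ} {v a : Fin n →₀ ℕ} {j : Fin n} (hv : v j ≤ c) (ha : c < a j)
    (hva : v ≤ a) : v ≤ a - Finsupp.single j 1 := by
  intro l
  have := hva l
  rcases eq_or_ne l j with rfl | hl
  · simp; omega
  · simpa [Finsupp.single_apply, hl.symm] using this

/-- The product `m^k J` has linear quotients as soon as `k > n c`, where `c` bounds all exponents
of the generators of `J`. -/
theorem IsMonomialIdeal.hasLinearQuotients_pow_mul {J : Ideal (MvPolynomial (Fin n) K)}
    (hJ : IsMonomialIdeal J) {c : ℕ} (hc : ∀ v ∈ minGens J, ∀ i, v i ≤ c) {k : ℕ}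
    (hk : n * c < k) : HasLinearQuotients (idealOfVars (Fin n) K ^ k * J) := by
  set M := idealOfVars (Fin n) K ^ k * J with hM
  have memM : ∀ a, monomial a (1 : K) ∈ M ↔
      ∃ v ∈ minGens J, v ≤ a ∧ v.degree + k ≤ a.degree := by
    intro a
    rw [hM, monomial_mem_pow_mul_iff hJ]
    constructor
    · rintro ⟨v, hv, hva, hd⟩
      obtain ⟨w, hw, hwv⟩ := exists_minGens_le hv
      have := Finsupp.degree_mono hwv
      exact ⟨w, hw, hwv.trans hva, by omega⟩
    · rintro ⟨v, hv, h⟩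
      exact ⟨v, hv.1, h⟩
  -- With truncated subtraction, the defect measures how far the exponents fall short of $c$;
  -- exponents above $c$ contribute nothing. Generators are ordered by degree, then defect, then
  -- lexicographically, the last making the key injective.
  let defect : (Fin n →₀ ℕ) → ℕ := fun a => ∑ i, (c - a i)
  let key : (Fin n →₀ ℕ) → ℕ ×ₗ ℕ ×ₗ Lex (Fin n →₀ ℕ) :=
    fun a => toLex (a.degree, toLex (defect a, toLex a))
  have key_lt : ∀ a b, key a < key b ↔ a.degree < b.degree ∨ a.degree = b.degree ∧
      (defect a < defect b ∨ defect a = defect b ∧ toLex a < toLex b) := by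
    intro a b
    simp only [key, Prod.Lex.toLex_lt_toLex]
  refine (hJ.pow_mul k).hasLinearQuotients_of_key key (fun a b hab => ?_) ?_
  · simp only [key, toLex_inj, Prod.mk.injEq] at hab
    exact hab.2.2
  intro u hu w hw hlt
  obtain ⟨v, hv, hvu, hdu⟩ := (memM u).1 hu.1
  -- Replacing `x_j` by `x_i` in `u`, for an exponent of `x_j` exceeding `c`.
  have move : ∀ i j, i ≠ j → c < u j →
      (defect (u + Finsupp.single i 1 - Finsupp.single j 1) < defect u ∨
        defect (u + Finsupp.single i 1 - Finsupp.single j 1) = defect u ∧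
        toLex (u + Finsupp.single i 1 - Finsupp.single j 1) < toLex u) →
      ∃ u' ∈ minGens M, key u' < key u ∧ u' ≤ u + Finsupp.single i 1 := by
    intro i j hij hj hdef
    set u'' := u + Finsupp.single i 1 - Finsupp.single j 1 with hu''
    have hj' : (u + Finsupp.single i 1 : Fin n →₀ ℕ) j ≠ 0 := by simp; omega
    have hdeg : u''.degree = u.degree := by
      have := degree_sub_single hj'
      rw [← hu''] at this
      simp only [map_add, Finsupp.degree_single] at this
      omega
    have hmem : monomial u'' (1 : K) ∈ M := by
      refine (memM _).2 ⟨v, hv, ?_, by omega⟩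
      refine le_sub_single (hc v hv j) ?_ (hvu.trans le_self_add)
      simp; omega
    obtain ⟨u', hu', hle⟩ := exists_minGens_le hmem
    refine ⟨u', hu', ?_, hle.trans tsub_le_self⟩
    rw [key_lt]
    rcases (Finsupp.degree_mono hle).lt_or_eq with h | h
    · exact Or.inl (h.trans_eq hdeg)
    · have : u' = u'' := by
        obtain ⟨d, hd⟩ := le_iff_exists_add.1 hle
        have : d.degree = 0 := by simpa [hd] using h
        rw [Finsupp.degree_eq_zero_iff] at this
        simp [hd, this]
      subst this
      exact Or.inr ⟨hdeg, hdef⟩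
  -- Raising an exponent below $c$ lowers the defect, and it is paid for by an exponent above $c$,
  -- whose reduction by one costs no defect.
  have move_up : ∀ i, u i < w i → u i < c →
      ∃ i, u i < w i ∧ ∃ u' ∈ minGens M, key u' < key u ∧ u' ≤ u + Finsupp.single i 1 := by
    intro i hi hic
    obtain ⟨j, hj⟩ := exists_lt_apply_of_mul_lt_degree (c := c) (a := u) (by omega)
    have hij : i ≠ j := by rintro rfl; omega
    refine ⟨i, hi, move i j hij hj (Or.inl ?_)⟩
    refine Finset.sum_lt_sum (fun l _ => ?_) ⟨i, Finset.mem_univ _, ?_⟩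
    · rcases eq_or_ne l j with rfl | hl
      · simp [hij]; omega
      · simp [Finsupp.single_apply, hl.symm]; omega
    · simp [hij.symm]; omega
  by_cases hup : ∃ i, u i < w i ∧ u i < c
  · obtain ⟨i, hi, hic⟩ := hup
    exact move_up i hi hic
  push Not at hup
  rw [key_lt] at hlt
  rcases hlt with hlt | ⟨hdeg, hlt⟩
  -- From here on, $u_i<w_i$ forces $u_i\ge c$. A generator $v'$ of $J$ dividing $w$ has exponents
  -- at most $c$, so it also divides $u$. As $\deg u>\deg w$, a variable could be cancelled from $u$
  -- inside $M$, contradicting minimality.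
  · exfalso
    obtain ⟨v', hv', hvw, hdw⟩ := (memM w).1 hw.1
    have hle : v' ≤ u := by
      intro i
      by_contra! hi
      have h1 := hup i (hi.trans_le (hvw i))
      have h2 := hc v' hv' i
      omega
    have hne : v'.degree < u.degree := by omega
    obtain ⟨j, hj⟩ : ∃ j, v' j < u j := by
      by_contra! hcon
      exact absurd (Finsupp.degree_mono (show u ≤ v' from hcon)) (by omega)
    have hle' : v' ≤ u - Finsupp.single j 1 := by
      intro l
      have := hle l
      rcases eq_or_ne l j with rfl | hl
      · simp; omega
      · simpa [Finsupp.single_apply, hl.symm] using this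
    have hd := degree_sub_single (a := u) (i := j) (by omega)
    have hmem : monomial (u - Finsupp.single j 1) (1 : K) ∈ M :=
      (memM _).2 ⟨v', hv', hle', by omega⟩
    have := hu.2 hmem tsub_le_self j
    simp at this
    omega
  -- In equal degree the defects must agree termwise, so $w$ precedes $u$ lexicographically. At the
  -- first difference $j$, $w_j<u_j$ with equal truncated differences forces $u_j>c$. Moving one
  -- unit from $j$ to a later $i$ with $c\le u_i<w_i$ preserves the defect and lowers the
  -- lexicographic order.
  · have hpt : ∀ i, c - u i ≤ c - w i := by
      intro i
      by_cases h : u i < w i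
      · have := hup i h; omega
      · omega
    have hle : defect u ≤ defect w := Finset.sum_le_sum fun i _ => hpt i
    obtain ⟨hEq, hlex⟩ : defect w = defect u ∧ toLex w < toLex u := by
      rcases hlt with h | h
      · omega
      · exact h
    have hpt' : ∀ i, c - u i = c - w i := fun i =>
      (Finset.sum_eq_sum_iff_of_le fun i _ => hpt i).1 hEq.symm i (Finset.mem_univ i)
    rw [Finsupp.Lex.lt_iff] at hlex
    obtain ⟨j, hjl, hj⟩ := hlex
    replace hjl : ∀ l < j, w l = u l := hjl
    replace hj : w j < u j := hj
    obtain ⟨i, hi⟩ : ∃ i, u i < w i := by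
      by_contra! hcon
      have : w.degree < u.degree := by
        rw [Finsupp.degree_eq_sum, Finsupp.degree_eq_sum]
        exact Finset.sum_lt_sum (fun i _ => hcon i) ⟨j, Finset.mem_univ _, hj⟩
      omega
    have hji : j < i := by
      rcases lt_trichotomy i j with h | h | h
      · have := hjl i h; omega
      · subst h; omega
      · exact h
    have hcj : c < u j := by have := hpt' j; omega
    have hci : c ≤ u i := hup i hi
    refine ⟨i, hi, move i j hji.ne' hcj (Or.inr ⟨?_, ?_⟩)⟩
    · refine Finset.sum_congr rfl fun l _ => ?_
      rcases eq_or_ne l j with rfl | hl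
      · simp [hji.ne']; omega
      · rcases eq_or_ne l i with rfl | hl'
        · simp [hl.symm]; omega
        · simp [hl.symm, hl'.symm]
    · rw [Finsupp.Lex.lt_iff]
      refine ⟨j, fun l hl => ?_, ?_⟩
      · change (u + Finsupp.single i 1 - Finsupp.single j 1 : Fin n →₀ ℕ) l = u l
        simp [hl.ne', (hl.trans hji).ne']
      · change (u + Finsupp.single i 1 - Finsupp.single j 1 : Fin n →₀ ℕ) j < u j
        simp [hji.ne']; omega

/-! ### Vanishing of Koszul homology in high degrees. -/

theorem neg_one_pow_eq_C (m : ℕ) : ((-1) ^ m : MvPolynomial (Fin n) K) = C ((-1) ^ m) := by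
  simp

theorem coeff_neg_one_pow_mul (m : ℕ) (f : MvPolynomial (Fin n) K) (a : Fin n →₀ ℕ) :
    coeff a ((-1) ^ m * f) = (-1) ^ m * coeff a f := by
  rw [neg_one_pow_eq_C, coeff_C_mul]

theorem coeff_sign_mul_X_mul (m : ℕ) (p : Fin n) (f : MvPolynomial (Fin n) K)
    (a : Fin n →₀ ℕ) : coeff a ((-1) ^ m * X p * f) =
      (-1) ^ m * if a p = 0 then 0 else coeff (a - Finsupp.single p 1) f := by
  rw [mul_assoc, coeff_neg_one_pow_mul, coeff_X_mul']
  by_cases h : a p = 0 <;> simp [h]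

open Classical in
/-- The sum of the terms of a polynomial whose exponent vectors satisfy `P`. -/
def restrictTerms (P : (Fin n →₀ ℕ) → Prop) (f : MvPolynomial (Fin n) K) :
    MvPolynomial (Fin n) K :=
  ∑ a ∈ f.support.filter P, monomial a (coeff a f)

theorem coeff_restrictTerms (P : (Fin n →₀ ℕ) → Prop) (f : MvPolynomial (Fin n) K)
    (a : Fin n →₀ ℕ) [Decidable (P a)] : coeff a (restrictTerms P f) = if P a then coeff a f else 0 := by
  simp only [restrictTerms, coeff_sum, coeff_monomial, Finset.sum_ite_eq', Finset.mem_filter,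
    mem_support_iff]
  by_cases h : P a <;> by_cases h' : coeff a f = 0 <;> simp [h, h']

/-- The part of a Koszul chain in multidegrees whose `l`-th entry exceeds `c`; here
`x^a e_F` has multidegree `a + ∑_{i ∈ F} e_i`. -/
def largePart (c : ℕ) (l : Fin n) (x : Finset (Fin n) → MvPolynomial (Fin n) K) :
    Finset (Fin n) → MvPolynomial (Fin n) K :=
  fun F => restrictTerms (fun a => c < a l + if l ∈ F then 1 else 0) (x F)

/-- The Koszul differential preserves the $\mathbb Z^n$-grading, and the truncation depends only on
the multidegree. -/
theorem koszulD_largePart (c : ℕ) (l : Fin n)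
    (x : Finset (Fin n) → MvPolynomial (Fin n) K) :
    koszulD K n (largePart c l x) = largePart c l (koszulD K n x) := by
  classical
  ext G a
  have hQ : ∀ p ∈ Gᶜ, a p ≠ 0 → ((c < (a - Finsupp.single p 1 : Fin n →₀ ℕ) l +
      if l ∈ insert p G then 1 else 0) ↔ c < a l + if l ∈ G then 1 else 0) := by
    intro p hp hap
    have hpG : p ∉ G := by simpa using hp
    rcases eq_or_ne l p with rfl | hl
    · simp [hpG]; omega
    · simp [hl]
  rw [koszulD_apply, largePart, coeff_restrictTerms, koszulD_apply, coeff_sum, coeff_sum]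
  by_cases hc : c < a l + if l ∈ G then 1 else 0
  · rw [if_pos hc]
    refine Finset.sum_congr rfl fun p hp => ?_
    rw [coeff_sign_mul_X_mul, coeff_sign_mul_X_mul]
    by_cases hap : a p = 0
    · simp [hap]
    · rw [if_neg hap, if_neg hap, largePart, coeff_restrictTerms, if_pos ((hQ p hp hap).2 hc)]
  · rw [if_neg hc]
    refine Finset.sum_eq_zero fun p hp => ?_
    rw [coeff_sign_mul_X_mul]
    by_cases hap : a p = 0
    · simp [hap]
    · rw [if_neg hap, largePart, coeff_restrictTerms, if_neg (mt (hQ p hp hap).1 hc), mul_zero]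

/-- Left multiplication by $e_l$ is a homotopy for multiplication by $x_l$: for a cycle,
$\partial(e_l\wedge x)=x_l x$. Only the $x_F$ with $l\notin F$ enter $e_l\wedge x$, so divisibility
by $x_l$ is needed only there. The sign is that of moving $e_l$ into its place in $e_G$. -/
theorem koszulD_contraction (l : Fin n) {x d : Finset (Fin n) → MvPolynomial (Fin n) K}
    (hx : koszulD K n x = 0) (hd : ∀ F, l ∉ F → x F = X l * d F) :
    koszulD K n (fun G => if l ∈ G then
      (-1) ^ (G.filter (· < l)).card * d (G.erase l) else 0) = x := by
  classical
  ext1 G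
  rw [koszulD_apply]
  by_cases hl : l ∈ G
  -- After multiplication by $x_l$ each $d$ becomes an $x$, and the sum is read off from the cycle
  -- equation at $G\setminus\{l\}$.
  · apply mul_left_cancel₀ (X_ne_zero (R := K) l)
    set H := G.erase l with hH
    have hlH : l ∉ H := Finset.notMem_erase l G
    have hG : G = insert l H := (Finset.insert_erase hl).symm
    have h0 := congrFun hx H
    have hcompl : Hᶜ = insert l Gᶜ := by
      rw [hH, Finset.compl_erase]
    rw [koszulD_apply, hcompl, Finset.sum_insert (by simpa using hl), ← hG, Pi.zero_apply] at h0
    have hcard : ∀ p q : Fin n, p ∉ H → (((insert p H).filter (· < q)).card) =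
        (H.filter (· < q)).card + if p < q then 1 else 0 := by
      intro p q hp
      rw [Finset.filter_insert]; split_ifs <;> simp [hp]
    rw [Finset.mul_sum]
    have hterm : ∀ p ∈ Gᶜ, X l * ((-1) ^ (G.filter (· < p)).card * X p *
        (if l ∈ insert p G then (-1) ^ ((insert p G).filter (· < l)).card *
          d ((insert p G).erase l) else 0)) =
        -((-1) ^ (H.filter (· < l)).card *
          ((-1) ^ (H.filter (· < p)).card * X p * x (insert p H))) := by
      intro p hp
      have hpG : p ∉ G := by simpa using hp
      have hpl : p ≠ l := by rintro rfl; exact hpG hl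
      have hpH : p ∉ H := fun h => hpG (Finset.mem_of_mem_erase h)
      have h1 : (insert p G).erase l = insert p H := by
        rw [hH, Finset.erase_insert_of_ne hpl]
      have h2 : l ∉ insert p H := by simp [hpl.symm, hlH]
      rw [if_pos (Finset.mem_insert_of_mem hl), h1, hd _ h2]
      have h3 : ((insert p G).filter (· < l)).card =
          (H.filter (· < l)).card + if p < l then 1 else 0 := by
        rw [hG, Finset.insert_comm, Finset.filter_insert, if_neg (lt_irrefl l), hcard p l hpH]
      have h4 : (G.filter (· < p)).card = (H.filter (· < p)).card + if l < p then 1 else 0 := by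
        conv_lhs => rw [hG]
        exact hcard l p hlH
      rw [h3, h4]
      rcases lt_or_gt_of_ne hpl with h | h
      · simp [h, h.not_gt, pow_succ]; ring
      · simp [h, h.not_gt, pow_succ]; ring
    rw [Finset.sum_congr rfl hterm, Finset.sum_neg_distrib, ← Finset.mul_sum,
      eq_neg_of_add_eq_zero_right h0]
    have : ((-1) ^ (H.filter (· < l)).card * (-1) ^ (H.filter (· < l)).card :
        MvPolynomial (Fin n) K) = 1 := by
      rw [← mul_pow]; simp
    linear_combination X l * x G * this
  · rw [Finset.sum_eq_single l]
    · rw [if_pos (Finset.mem_insert_self l G), Finset.erase_insert hl, hd G hl,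
        Finset.filter_insert, if_neg (lt_irrefl l)]
      have : ((-1) ^ (G.filter (· < l)).card * (-1) ^ (G.filter (· < l)).card :
          MvPolynomial (Fin n) K) = 1 := by
        rw [← mul_pow]; simp
      linear_combination X l * d G * this
    · intro p _ hpl
      rw [if_neg (by simp [hl, hpl.symm]), mul_zero]
    · intro h
      exact absurd (Finset.mem_compl.2 hl) h

/-- Koszul cycles of a monomial ideal `M` in a bidegree where monomials of `M` can be divided by
any variable with large exponent are boundaries. -/
theorem IsMonomialIdeal.koszulCycles_le_koszulBoundaries {M : Ideal (MvPolynomial (Fin n) K)}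
    (hM : IsMonomialIdeal M) {c i j : ℕ} (hj : n * c < j)
    (hdiv : ∀ a l, monomial a (1 : K) ∈ M → a.degree + i = j → c < a l →
      monomial (a - Finsupp.single l 1) (1 : K) ∈ M) :
    koszulCycles M i j ≤ koszulBoundaries M i j := by
  classical
  -- Induction on a set $s$ of indices such that every multidegree of the cycle has an entry above
  -- $c$ at some index of $s$. All indices suffice at the start, since the entries sum to $j>nc$;
  -- each step splits off the part that is large at one index.
  suffices h : ∀ s : Finset (Fin n), ∀ x ∈ koszulCycles M i j,
      (∀ F, ∀ a ∈ (x F).support, ∃ l ∈ s, c < a l + if l ∈ F then 1 else 0) →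
      x ∈ koszulBoundaries M i j by
    intro x hx
    refine h Finset.univ x hx fun F a ha => ?_
    have hF : F.card = i := by
      by_contra hne
      simp [(hx.1 F).2.1 hne] at ha
    have hdeg := (hx.1 F).2.2 a ha
    by_contra! hcon
    have h1 : ∑ l, (a l + if l ∈ F then 1 else 0) ≤ ∑ _l : Fin n, c :=
      Finset.sum_le_sum fun l _ => hcon l (Finset.mem_univ l)
    rw [Finset.sum_add_distrib, ← Finsupp.degree_eq_sum] at h1
    simp [hF] at h1
    omega
  intro s
  induction s using Finset.induction_on with
  | empty =>
    intro x _ h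
    have : x = 0 := by
      ext1 F
      rw [Pi.zero_apply, ← support_eq_empty, Finset.eq_empty_iff_forall_notMem]
      intro a ha
      simpa using h F a ha
    rw [this]
    exact zero_mem _
  | insert l s _ ih =>
    intro x hx hsup
    set y := largePart c l x with hy
    have hycoeff : ∀ F a, coeff a (y F) =
        if c < a l + (if l ∈ F then 1 else 0) then coeff a (x F) else 0 := by
      intro F a
      rw [hy, largePart, coeff_restrictTerms]
    have hysupp : ∀ F a, a ∈ (y F).support →
        c < a l + (if l ∈ F then 1 else 0) ∧ a ∈ (x F).support := by
      intro F a ha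
      rw [mem_support_iff, hycoeff] at ha
      by_cases h : c < a l + (if l ∈ F then 1 else 0)
      · rw [if_pos h] at ha
        exact ⟨h, mem_support_iff.2 ha⟩
      · rw [if_neg h] at ha
        exact absurd rfl ha
    have hDx : koszulD K n x = 0 := LinearMap.mem_ker.1 hx.2
    have hDy : koszulD K n y = 0 := by
      rw [hy, koszulD_largePart, hDx]
      ext F a
      simp [largePart, coeff_restrictTerms]
    have hyM : y ∈ koszulCycles M i j := by
      refine ⟨fun F => ⟨?_, fun hF => ?_, fun a ha => (hx.1 F).2.2 a (hysupp F a ha).2⟩, hDy⟩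
      · rw [hM.mem_iff]
        intro a ha
        exact hM.mem_iff.1 (hx.1 F).1 a (hysupp F a ha).2
      · ext a
        rw [hycoeff, (hx.1 F).2.1 hF]
        simp
    have hz : x - y ∈ koszulBoundaries M i j := by
      refine ih (x - y) (sub_mem hx hyM) fun F a ha => ?_
      rw [mem_support_iff, Pi.sub_apply, coeff_sub, hycoeff] at ha
      by_cases h : c < a l + (if l ∈ F then 1 else 0)
      · rw [if_pos h, sub_self] at ha
        exact absurd rfl ha
      · rw [if_neg h, sub_zero] at ha
        obtain ⟨l', hl', hlt⟩ := hsup F a (mem_support_iff.2 ha)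
        rcases Finset.mem_insert.1 hl' with rfl | hl'
        · exact absurd hlt h
        · exact ⟨l', hl', hlt⟩
    -- For $l\notin F$ the $l$-th multidegree entry is the exponent itself, so every term of $y_F$
    -- is divisible by $x_l$, and `hdiv` keeps the quotient in $M$.
    have hyB : y ∈ koszulBoundaries M i j := by
      let d : Finset (Fin n) → MvPolynomial (Fin n) K :=
        fun F => (y F).divMonomial (Finsupp.single l 1)
      have hd : ∀ F, l ∉ F → y F = X l * d F := by
        intro F hF
        ext a
        rw [coeff_X_mul']
        split_ifs with ha
        · have : Finsupp.single l 1 ≤ a := by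
            rw [Finsupp.single_le_iff]
            have := Finsupp.mem_support_iff.1 ha
            omega
          rw [coeff_divMonomial, add_tsub_cancel_of_le this]
        · rw [hycoeff, if_neg]
          rw [Finsupp.notMem_support_iff] at ha
          simp [ha, hF]
      refine ⟨_, ?_, koszulD_contraction l hDy hd⟩
      intro G
      by_cases hl : l ∈ G
      · simp only [if_pos hl]
        have hlG : l ∉ G.erase l := Finset.notMem_erase l G
        have key : ∀ a, coeff a ((-1) ^ (G.filter (· < l)).card * d (G.erase l)) ≠ 0 →
            Finsupp.single l 1 + a ∈ (y (G.erase l)).support := by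
          intro a ha
          rw [coeff_neg_one_pow_mul, coeff_divMonomial] at ha
          exact mem_support_iff.2 (right_ne_zero_of_mul ha)
        refine ⟨?_, fun hG => ?_, fun a ha => ?_⟩
        · rw [hM.mem_iff]
          intro a ha
          have h1 := key a (mem_support_iff.1 ha)
          have h2 := (hysupp _ _ h1).1
          rw [if_neg hlG, add_zero] at h2
          have := hdiv _ l (hM.mem_iff.1 (hyM.1 _).1 _ h1) ((hyM.1 _).2.2 _ h1) h2
          rwa [add_tsub_cancel_left] at this
        · have : y (G.erase l) = 0 := by
            refine (hyM.1 _).2.1 ?_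
            rw [Finset.card_erase_of_mem hl]
            have := Finset.card_pos.2 ⟨l, hl⟩
            omega
          simp [d, this]
        · have := (hyM.1 _).2.2 _ (key a (mem_support_iff.1 ha))
          simp only [map_add, Finsupp.degree_single] at this
          omega
      · simp [if_neg hl]
    rw [← add_sub_cancel y x]
    exact add_mem hyB hz

/-! ### Betti numbers and bounds for the regularity. -/

theorem gradedBetti_eq_zero_of_le {M : Ideal (MvPolynomial (Fin n) K)} {i j : ℕ}
    (h : koszulCycles M i j ≤ koszulBoundaries M i j) : gradedBetti M i j = 0 := by
  rw [gradedBetti]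
  have : (koszulBoundaries M i j).submoduleOf (koszulCycles M i j) = ⊤ :=
    Submodule.submoduleOf_eq_top.2 h
  have : Subsingleton (gradedTor M i j) := by
    rw [gradedTor, this]
    infer_instance
  exact rank_subsingleton' K _

/-- Minimal generators give nonzero classes in `Tor_0`. -/
theorem gradedBetti_zero_ne_zero {M : Ideal (MvPolynomial (Fin n) K)} (hM : IsMonomialIdeal M)
    {u : Fin n →₀ ℕ} (hu : u ∈ minGens M) : gradedBetti M 0 u.degree ≠ 0 := by
  classical
  intro h0
  rw [gradedBetti, rank_zero_iff] at h0
  have htop := Submodule.Quotient.subsingleton_iff.1 h0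
  rw [Submodule.submoduleOf_eq_top] at htop
  let x : Finset (Fin n) → MvPolynomial (Fin n) K := Pi.single ∅ (monomial u 1)
  have hx : x ∈ koszulCycles M 0 u.degree := by
    refine ⟨fun F => ?_, ?_⟩
    · by_cases hF : F = ∅
      · subst hF
        simp only [x, Pi.single_eq_same]
        refine ⟨hu.1, by simp, fun a ha => ?_⟩
        have := support_monomial_subset ha
        rw [Finset.mem_singleton] at this
        rw [this, add_zero]
      · simp [x, hF]
    · rw [SetLike.mem_coe, LinearMap.mem_ker]
      ext1 G
      rw [koszulD_apply]
      refine Finset.sum_eq_zero fun p _ => ?_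
      simp [x]
  -- If $x^u e_\emptyset$ were a boundary, comparing coefficients of $x^u$ would put some $x^u/x_p$
  -- in $M$.
  obtain ⟨y, hy, hyx⟩ := htop hx
  have h1 := congrArg (coeff u) (congrFun hyx ∅)
  rw [koszulD_apply, coeff_sum] at h1
  simp only [x, Pi.single_eq_same, coeff_monomial, if_true] at h1
  obtain ⟨p, -, hp⟩ := Finset.exists_ne_zero_of_sum_ne_zero (h1.trans_ne one_ne_zero)
  rw [coeff_sign_mul_X_mul] at hp
  have hp' := right_ne_zero_of_mul hp
  have hup : u p ≠ 0 := fun h => hp' (if_pos h)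
  rw [if_neg hup] at hp'
  have hmem := hM.mem_iff.1 (hy _).1 _ (mem_support_iff.2 hp')
  have := hu.2 hmem tsub_le_self p
  simp at this
  omega

theorem le_reg {M : Ideal (MvPolynomial (Fin n) K)} (hM : IsMonomialIdeal M)
    {u : Fin n →₀ ℕ} (hu : u ∈ minGens M) : ((u.degree : ℝ) : EReal) ≤ reg M :=
  le_sSup ⟨0, u.degree, gradedBetti_zero_ne_zero hM hu, by simp⟩

theorem reg_le {M : Ideal (MvPolynomial (Fin n) K)} {D : ℕ}
    (h : ∀ i j, i + D < j → gradedBetti M i j = 0) : reg M ≤ ((D : ℝ) : EReal) := by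
  refine sSup_le ?_
  rintro _ ⟨i, j, hij, rfl⟩
  have : j ≤ i + D := by
    by_contra! hlt
    exact hij (h i j hlt)
  rw [EReal.coe_le_coe_iff]
  have : (j : ℝ) ≤ i + D := by exact_mod_cast this
  linarith

/-- The regularity of `m^k J` for `k > n c`, with `c` bounding all exponents of the generators
of `J`, is at most the largest degree of a generator. -/
theorem IsMonomialIdeal.reg_pow_mul_le {J : Ideal (MvPolynomial (Fin n) K)}
    (hJ : IsMonomialIdeal J) {c : ℕ} (hc : ∀ v ∈ minGens J, ∀ i, v i ≤ c) {k : ℕ}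
    (hk : n * c < k) {D : ℕ}
    (hD : ∀ u ∈ minGens (idealOfVars (Fin n) K ^ k * J), u.degree ≤ D) :
    reg (idealOfVars (Fin n) K ^ k * J) ≤ ((D : ℝ) : EReal) := by
  refine reg_le fun i j hij => gradedBetti_eq_zero_of_le ?_
  by_cases hkD : k ≤ D
  · refine (hJ.pow_mul k).koszulCycles_le_koszulBoundaries (c := c) (by omega) ?_
    -- Here $\deg a=j-i>D$, so $a/x_l$ still has degree at least $D\ge\deg v+k$ for a generator $v$
    -- of $J$, and $v$ divides it because $v_l\le c<a_l$.
    intro a l ha hdeg hl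
    obtain ⟨u, hu, hua⟩ := exists_minGens_le ha
    obtain ⟨w, hw, hwu, hdw⟩ := (monomial_mem_pow_mul_iff hJ).1 hu.1
    obtain ⟨v, hv, hvw⟩ := exists_minGens_le hw
    have h1 := hD u hu
    have h2 := Finsupp.degree_mono hvw
    have h3 := degree_sub_single (a := a) (i := l) (by omega)
    exact (monomial_mem_pow_mul_iff hJ).2
      ⟨v, hv.1, le_sub_single (hc v hv l) hl (hvw.trans (hwu.trans hua)), by omega⟩
  -- Generators of $\mathfrak m^kJ$ have degree at least $k$, so $k>D$ leaves only the zero ideal.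
  · have hempty : ∀ a, monomial a (1 : K) ∉ idealOfVars (Fin n) K ^ k * J := by
      intro a ha
      obtain ⟨u, hu, -⟩ := exists_minGens_le ha
      obtain ⟨v, -, -, hd⟩ := (monomial_mem_pow_mul_iff hJ).1 hu.1
      have := hD u hu
      omega
    intro x hx
    have : x = 0 := by
      ext1 F
      rw [Pi.zero_apply, ← support_eq_empty, Finset.eq_empty_iff_forall_notMem]
      intro a ha
      exact hempty a ((hJ.pow_mul k).mem_iff.1 (hx.1 F).1 a ha)
    rw [this]
    exact zero_mem _

end MonomialGradient

end

/-! ### The main theorem. -/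

theorem corollary2p4 {K : Type*} [Field K] (n : ℕ) (hn : 0 < n)
    (I : Ideal (MvPolynomial (Fin n) K)) (hI : MonomialGradient.IsMonomialIdeal I) :
    ∃ k₀ : ℕ, ∀ k ≥ k₀,
      (CharZero K ∨
        (MonomialGradient.gradient I = MonomialGradient.gradientStar I ∧
          MonomialGradient.gradient (MvPolynomial.idealOfVars (Fin n) K ^ k * I) =
            MonomialGradient.gradientStar (MvPolynomial.idealOfVars (Fin n) K ^ k * I))) →
      (I ≠ ⊤ →
        MonomialGradient.gradient (MvPolynomial.idealOfVars (Fin n) K ^ k * I) =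
          MvPolynomial.idealOfVars (Fin n) K ^ k * MonomialGradient.gradient I) ∧
      MonomialGradient.HasLinearQuotients
        (MonomialGradient.gradient (MvPolynomial.idealOfVars (Fin n) K ^ k * I)) ∧
      (I ≠ ⊥ →
        MonomialGradient.reg
            (MonomialGradient.gradient (MvPolynomial.idealOfVars (Fin n) K ^ k * I)) <
          MonomialGradient.reg (MvPolynomial.idealOfVars (Fin n) K ^ k * I)) := by
  classical
  -- The shift $t$ is needed only for $I=S$, where $\partial^*(\mathfrak m^{k+1})=\mathfrak m^k$
  -- makes $J=S$, $t=1$ work although $\partial^*(S)=0$.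
  obtain ⟨J, hJ, t, hJt⟩ : ∃ J : Ideal (MvPolynomial (Fin n) K),
      MonomialGradient.IsMonomialIdeal J ∧ ∃ t : ℕ, ∀ k,
        MonomialGradient.gradientStar (MvPolynomial.idealOfVars (Fin n) K ^ (k + t) * I) =
          MvPolynomial.idealOfVars (Fin n) K ^ k * J := by
    by_cases hT : I = ⊤
    · refine ⟨⊤, hT ▸ hI, 1, fun k => ?_⟩
      rw [hT, Ideal.mul_top, Ideal.mul_top, MonomialGradient.gradientStar_pow_idealOfVars hn]
    · exact ⟨_, MonomialGradient.isMonomialIdeal_gradientStar I, 0, fun k =>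
        MonomialGradient.gradientStar_pow_mul hI hT k⟩
  obtain ⟨c, hc⟩ : ∃ c, ∀ v ∈ MonomialGradient.minGens J, ∀ i, v i ≤ c := by
    refine ⟨(MonomialGradient.minGens_finite J).toFinset.sup Finsupp.degree,
      fun v hv i => (Finsupp.le_degree i v).trans ?_⟩
    exact Finset.le_sup ((Set.Finite.mem_toFinset _).2 hv)
  refine ⟨n * c + 1 + t, fun k hk hchar => ?_⟩
  obtain ⟨l, rfl⟩ : ∃ l, k = l + t := ⟨k - t, by omega⟩
  have hl : n * c < l := by omega
  obtain ⟨h1, h2⟩ : MonomialGradient.gradient I = MonomialGradient.gradientStar I ∧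
      MonomialGradient.gradient (MvPolynomial.idealOfVars (Fin n) K ^ (l + t) * I) =
        MonomialGradient.gradientStar (MvPolynomial.idealOfVars (Fin n) K ^ (l + t) * I) := by
    rcases hchar with h | h
    · exact ⟨MonomialGradient.gradient_eq_gradientStar _,
        MonomialGradient.gradient_eq_gradientStar _⟩
    · exact h
  refine ⟨fun hT => ?_, ?_, fun hB => ?_⟩
  · rw [h1, h2, MonomialGradient.gradientStar_pow_mul hI hT]
  · rw [h2, hJt]
    exact hJ.hasLinearQuotients_pow_mul hc hl
  · set M := MvPolynomial.idealOfVars (Fin n) K ^ (l + t) * I with hM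
    have hMmon : MonomialGradient.IsMonomialIdeal M := hI.pow_mul _
    obtain ⟨v, hv⟩ : ∃ v, MvPolynomial.monomial v (1 : K) ∈ I := by
      by_contra! hcon
      exact hB (le_bot_iff.1 (hI.le_of_monomial fun a ha => absurd ha (hcon a)))
    obtain ⟨w, hw, -⟩ := MonomialGradient.exists_minGens_le (I := M)
      ((MonomialGradient.monomial_mem_pow_mul_iff hI).2
        ⟨v, hv, le_self_add (b := Finsupp.single ⟨0, hn⟩ (l + t)), by simp⟩)
    obtain ⟨u, hu, humax⟩ := Set.exists_max_image _ Finsupp.degree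
      (MonomialGradient.minGens_finite M) ⟨w, hw⟩
    have hpos : 0 < u.degree := by
      obtain ⟨_, -, -, h⟩ := (MonomialGradient.monomial_mem_pow_mul_iff hI).1 hu.1
      omega
    -- The separating value is one less than the largest generator degree of $M$; `hpos` keeps the
    -- natural subtraction honest.
    refine lt_of_le_of_lt (b := (((u.degree - 1 : ℕ) : ℝ) : EReal)) ?_
      (lt_of_lt_of_le ?_ (MonomialGradient.le_reg hMmon hu))
    · rw [h2, hJt]
      refine hJ.reg_pow_mul_le hc hl fun b hb => ?_
      rw [← hJt] at hb
      obtain ⟨a, ha, hab⟩ := MonomialGradient.exists_of_mem_minGens_gradientStar hb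
      have := humax a ha
      omega
    · rw [EReal.coe_lt_coe_iff]
      exact_mod_cast Nat.sub_lt hpos one_pos
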